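/- Let $\Lambda$ be a countable left cancellative small category, regarded as its set of morphisms with source map $s$ and range map $r$; the product $\alpha\beta$ is defined when $s(\alpha)=r(\beta)$, and $\alpha\beta=\alpha\gamma$ implies $\beta=\gamma$. Write $\alpha\Lambda=\{\alpha\beta : r(\beta)=s(\alpha)\}$, $v\Lambda=\{\beta : r(\beta)=v\}$ and $v\Lambda w=\{\beta : r(\beta)=v,\ s(\beta)=w\}$ for objects $v,w$. Assume that $\Lambda$ is finitely aligned: for all $\alpha,\beta\in\Lambda$ there is a finite set $\Gamma\subseteq\Lambda$ with $\alpha\Lambda\cap\beta\Lambda=\bigcup_{\gamma\in\Gamma}\gamma\Lambda$. Let $\mathcal S_\Lambda$ be the subsemigroup of the symmetric inverse monoid $\mathcal I(\Lambda)$ of partial bijections of $\Lambda$ generated by the maps $\tau^\alpha: s(\alpha)\Lambda\to\alpha\Lambda$, $\beta\mapsto\alpha\beta$, and their inverses $\sigma^\alpha$ ($\alpha\in\Lambda$). It is an inverse semigroup, with $s^*=s^{-1}$; $0$ denotes the empty map. Let $\mathcal E$ be its set of idempotents, ordered by $e\le f\iff e=ef$. A set $Z\subseteq\mathcal E$ is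 an outer cover for $e\in\mathcal E$ if for every $g\in\mathcal E$ with $0\ne g\le e$ there is $z\in Z$ with $zg\neq 0$. A filter is a nonempty upward closed subset of $\mathcal E$ that is closed under products and does not contain $0$; the space of filters has the topology with basis the sets $\{\eta : X\subseteq\eta,\ Y\cap\eta=\emptyset\}$ for finite $X,Y\subseteq\mathcal E$. The space $\widehat{\mathcal E}_{tight}$ of tight filters is the closure of the set of maximal filters. For $s\in\mathcal S_\Lambda$ and a filter $\eta$ with $s^*s\in\eta$ put $s\cdot\eta=\{f\in\mathcal E : ses^*\le f\text{ for some }e\in\eta\}$. The tight groupoid $\mathcal G_{tight}(\mathcal S_\Lambda)$ is the groupoid of germs of this action on $\widehat{\mathcal E}_{tight}$: its elements are the classes $[s,\xi]$ with $s\in\mathcal S_\Lambda$, $s^*s\in\xi\in\widehat{\mathcal E}_{tight}$, where $[s,\xi]=[t,\xi]$ if and only if $se=te$ for some $e\in\xi$; the source of $[s,\xi]$ is $\xi$, its range is $s\cdot\xi$, $[s,t\cdot\xi][t,\xi]=[st,\xi]$ and $[s,\xi]^{-1}=[s^*,s\cdot\xi]$; a basis of its topology is given by the sets $\{[s,\xi]:\xi\in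 U\}$ with $s\in\mathcal S_\Lambda$ and $U$ open in $\widehat{\mathcal E}_{tight}$ such that $s^*s\in\xi$ for all $\xi\in U$. A topological groupoid is minimal if the only open invariant subsets of its unit space are the empty set and the whole unit space. Then the following are equivalent. 1. $\mathcal G_{tight}(\mathcal S_\Lambda)$ is minimal. 2. For all nonzero $e,f\in\mathcal E$ there are $s_1,\dots,s_n\in\mathcal S_\Lambda$ such that $\{s_ifs_i^*\}_{i=1}^n$ is an outer cover for $e$. 3. For all $\alpha,\beta\in\Lambda$ there is a finite set $F\subseteq r(\alpha)\Lambda$ that is exhaustive with respect to $\alpha$ (for every $\gamma\in\alpha\Lambda$ there is $\delta\in F$ with $\delta\Lambda\cap\gamma\Lambda\neq\emptyset$) and such that $s(\beta)\Lambda s(\gamma)\neq\emptyset$ for every $\gamma\in F$. -/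

import Mathlib

open CategoryTheory TopologicalSpace Topology

universe u v w

noncomputable section

namespace LCSC

/-! ### The symmetric inverse monoid and its inverse subsemigroups -/

section SymmetricInverse

variable {X : Type w}

/-- Composition in `Inv(X)`: `s * t` is the partial bijection `s ∘ t` (first `t`, then `s`), with
the largest possible domain. The zero of `Inv(X)` is the empty map `⊥`. -/
instance : Semigroup (X ≃. X) where
  mul s t := t.trans s
  mul_assoc s t r := (PEquiv.trans_assoc r t s).symm

/-- The involution of `Inv(X)`: the inverse partial bijection. -/
instance : StarMul (X ≃. X) where
  star s := s.symm
  star_involutive s := PEquiv.symm_symm s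
  star_mul s t := PEquiv.symm_trans_rev t s

theorem mem_mul {s t : X ≃. X} {a c : X} : c ∈ (s * t) a ↔ ∃ b, b ∈ t a ∧ c ∈ s b :=
  PEquiv.mem_trans t s a c

theorem mem_star {s : X ≃. X} {a b : X} : a ∈ (star s) b ↔ b ∈ s a :=
  PEquiv.mem_iff_mem s

theorem ext_mem {s t : X ≃. X} (h : ∀ a b, b ∈ s a ↔ b ∈ t a) : s = t :=
  PEquiv.ext fun a => Option.ext fun b => h a b

theorem mul_star_mul (s : X ≃. X) : s * star s * s = s := by
  refine ext_mem fun a b => ?_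
  simp only [mem_mul, mem_star]
  constructor
  · rintro ⟨c, hc, d, hd, hb⟩
    rwa [s.inj hc hd]
  · intro h
    exact ⟨b, h, a, h, h⟩

theorem idem_fix {e : X ≃. X} (he : e * e = e) {a b : X} (h : b ∈ e a) : b = a := by
  have h' : b ∈ (e * e) a := by rwa [he]
  obtain ⟨c, hc, hb⟩ := mem_mul.1 h'
  have : c = b := by simpa using Option.mem_unique hc h
  subst this
  exact e.inj hb h

theorem idem_comm {e f : X ≃. X} (he : e * e = e) (hf : f * f = f) : e * f = f * e := by
  refine ext_mem fun a b => ?_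
  simp only [mem_mul]
  constructor
  · rintro ⟨c, hc, hb⟩
    obtain rfl := idem_fix hf hc
    obtain rfl := idem_fix he hb
    exact ⟨_, hb, hc⟩
  · rintro ⟨c, hc, hb⟩
    obtain rfl := idem_fix he hc
    obtain rfl := idem_fix hf hb
    exact ⟨_, hb, hc⟩

theorem idem_star {e : X ≃. X} (he : e * e = e) : star e = e := by
  refine ext_mem fun a b => ?_
  rw [mem_star]
  constructor
  · intro h
    obtain rfl := idem_fix he h
    exact h
  · intro h
    obtain rfl := idem_fix he h
    exact h

/-- An inverse subsemigroup of the symmetric inverse monoid `Inv(X)`. -/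
structure InverseSubsemigroup (X : Type w) extends Subsemigroup (X ≃. X) where
  star_mem' : ∀ {s : X ≃. X}, s ∈ carrier → star s ∈ carrier

instance : Membership (X ≃. X) (InverseSubsemigroup X) where
  mem S s := s ∈ S.toSubsemigroup

variable (S : InverseSubsemigroup X)

variable {S} in
theorem smul_mem {s t : X ≃. X} (hs : s ∈ S) (ht : t ∈ S) : s * t ∈ S :=
  S.toSubsemigroup.mul_mem hs ht

variable {S} in
theorem sstar_mem {s : X ≃. X} (hs : s ∈ S) : star s ∈ S := S.star_mem' hs

/-- The semilattice `E` of idempotents of `S`. -/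
def Idem : Set (X ≃. X) := {e | e ∈ S ∧ e * e = e}

/-- The order of idempotents: `e ≤ f` iff `e = ef`. -/
def IdemLE (e f : X ≃. X) : Prop := e = e * f

variable {S}

theorem idem_mul {e f : X ≃. X} (he : e ∈ Idem S) (hf : f ∈ Idem S) : e * f ∈ Idem S := by
  refine ⟨smul_mem he.1 hf.1, ?_⟩
  calc e * f * (e * f) = e * (f * e) * f := by simp only [mul_assoc]
    _ = e * (e * f) * f := by rw [idem_comm hf.2 he.2]
    _ = (e * e) * (f * f) := by simp only [mul_assoc]
    _ = e * f := by rw [he.2, hf.2]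

theorem star_mul_self_idem {s : X ≃. X} (hs : s ∈ S) : star s * s ∈ Idem S := by
  refine ⟨smul_mem (sstar_mem hs) hs, ?_⟩
  rw [mul_assoc, ← mul_assoc s, mul_star_mul]

theorem self_mul_star_idem {s : X ≃. X} (hs : s ∈ S) : s * star s ∈ Idem S := by
  simpa using star_mul_self_idem (sstar_mem hs)

theorem conj_idem {s e : X ≃. X} (hs : s ∈ S) (he : e ∈ Idem S) : s * e * star s ∈ Idem S := by
  refine ⟨smul_mem (smul_mem hs he.1) (sstar_mem hs), ?_⟩
  calc s * e * star s * (s * e * star s) = s * (e * (star s * s)) * (e * star s) := by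
        simp only [mul_assoc]
    _ = s * ((star s * s) * e) * (e * star s) := by
        rw [idem_comm he.2 (star_mul_self_idem hs).2]
    _ = (s * star s * s) * (e * e) * star s := by simp only [mul_assoc]
    _ = s * e * star s := by rw [mul_star_mul, he.2]

theorem conj_mono {s e f : X ≃. X} (hs : s ∈ S) (he : e ∈ Idem S) (h : IdemLE e f) :
    IdemLE (s * e * star s) (s * f * star s) := by
  unfold IdemLE at *
  calc s * e * star s = (s * star s * s) * (e * f) * star s := by rw [mul_star_mul, ← h]
    _ = s * ((star s * s) * e) * f * star s := by simp only [mul_assoc]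
    _ = s * (e * (star s * s)) * f * star s := by
        rw [idem_comm he.2 (star_mul_self_idem hs).2]
    _ = s * e * star s * (s * f * star s) := by simp only [mul_assoc]

theorem idemLE_trans {e f g : X ≃. X} (h : IdemLE e f) (h' : IdemLE f g) : IdemLE e g := by
  unfold IdemLE at *
  calc e = e * f := h
    _ = e * (f * g) := by rw [← h']
    _ = e * g := by rw [← mul_assoc, ← h]

theorem idemLE_refl {e : X ≃. X} (he : e ∈ Idem S) : IdemLE e e := he.2.symm

variable (S)

/-- For sets `Z`, `F` of idempotents of `S`: `Z` is an outer cover for `F` if every nonzero element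
of `F` has nonzero product with some element of `Z`. -/
def IsOuterCover (Z F : Set (X ≃. X)) : Prop :=
  Z ⊆ Idem S ∧ ∀ f ∈ F, f ≠ ⊥ → ∃ z ∈ Z, z * f ≠ ⊥

/-- `Z` is an outer cover for the idempotent `e`, i.e. for the set of idempotents below `e`. -/
def IsOuterCoverOf (Z : Set (X ≃. X)) (e : X ≃. X) : Prop :=
  IsOuterCover S Z {f | f ∈ Idem S ∧ IdemLE f e}

/-! ### Filters and tight filters -/

/-- A (proper) filter of idempotents of `S`. -/
structure IsFilter (η : Set (X ≃. X)) : Prop where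
  subset_idem : η ⊆ Idem S
  nonempty : η.Nonempty
  bot_notMem : ⊥ ∉ η
  mem_of_le : ∀ {e f : X ≃. X}, e ∈ η → f ∈ Idem S → IdemLE e f → f ∈ η
  mul_mem : ∀ {e f : X ≃. X}, e ∈ η → f ∈ η → e * f ∈ η

/-- The space of filters of `S`. -/
def Filt : Type w := {η : Set (X ≃. X) // IsFilter S η}

/-- The topology of the space of filters, generated by the sets
`{η : A ⊆ η, B ∩ η = ∅}` with `A`, `B` finite sets of idempotents. -/
instance : TopologicalSpace (Filt S) :=
  generateFrom {U | ∃ A B : Set (X ≃. X), A.Finite ∧ B.Finite ∧ A ⊆ Idem S ∧ B ⊆ Idem S ∧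
    U = {η : Filt S | A ⊆ η.1 ∧ B ∩ η.1 = ∅}}

/-- The ultrafilters: the filters which are maximal with respect to inclusion. -/
def Ultra : Set (Filt S) := {η | ∀ ζ : Filt S, η.1 ⊆ ζ.1 → ζ = η}

/-- The space of tight filters: the closure of the set of ultrafilters, with the subspace
topology. -/
def Tight : Type w := {ξ : Filt S // ξ ∈ closure (Ultra S)}

instance : TopologicalSpace (Tight S) :=
  inferInstanceAs (TopologicalSpace {ξ : Filt S // ξ ∈ closure (Ultra S)})

variable {S}

/-- The set of idempotents belonging to a tight filter. -/
def Tight.carrier (ξ : Tight S) : Set (X ≃. X) := ξ.1.1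

theorem Tight.isFilter (ξ : Tight S) : IsFilter S ξ.carrier := ξ.1.2

theorem Tight.ext {ξ η : Tight S} (h : ξ.carrier = η.carrier) : ξ = η :=
  Subtype.ext (Subtype.ext h)

variable (S) in
/-- The action of `s` on a filter `η` with `s*s ∈ η`:
`s · η = {f ∈ E : s e s* ≤ f for some e ∈ η}`. -/
def act (s : X ≃. X) (η : Set (X ≃. X)) : Set (X ≃. X) :=
  {f | f ∈ Idem S ∧ ∃ e ∈ η, IdemLE (s * e * star s) f}

theorem conj_mem_act {η : Set (X ≃. X)} (hη : IsFilter S η) {s e : X ≃. X} (hs : s ∈ S)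
    (he : e ∈ η) : s * e * star s ∈ act S s η :=
  ⟨conj_idem hs (hη.subset_idem he), e, he, idemLE_refl (conj_idem hs (hη.subset_idem he))⟩

theorem act_idem {η : Set (X ≃. X)} (hη : IsFilter S η) {e : X ≃. X} (he : e ∈ η) :
    act S e η = η := by
  have hes : star e = e := idem_star (hη.subset_idem he).2
  apply Set.Subset.antisymm
  · rintro f ⟨hf, g, hg, hle⟩
    rw [hes] at hle
    exact hη.mem_of_le (hη.mul_mem (hη.mul_mem he hg) he) hf hle
  · intro f hf
    refine ⟨hη.subset_idem hf, f, hf, ?_⟩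
    rw [hes]
    have h1 := (hη.subset_idem he).2
    have h2 := (hη.subset_idem hf).2
    unfold IdemLE
    rw [mul_assoc, mul_assoc, mul_assoc, idem_comm h1 h2, ← mul_assoc f f, h2]

theorem act_mul {η : Set (X ≃. X)} (hη : IsFilter S η) {s t : X ≃. X} (hs : s ∈ S) (ht : t ∈ S) :
    act S (t * s) η = act S t (act S s η) := by
  ext f
  constructor
  · rintro ⟨hf, e, he, hle⟩
    refine ⟨hf, _, conj_mem_act hη hs he, ?_⟩
    rw [star_mul] at hle
    simpa only [mul_assoc] using hle
  · rintro ⟨hf, g, ⟨hg, e, he, hle'⟩, hle⟩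
    refine ⟨hf, e, he, ?_⟩
    have := idemLE_trans (conj_mono ht (conj_idem hs (hη.subset_idem he)) hle') hle
    rw [star_mul]
    simpa only [mul_assoc] using this

/-! ### The tight groupoid -/

/-- The pairs `(s, ξ)` with `s ∈ S`, `s*s ∈ ξ` and `s · ξ = η`. -/
structure PreGerm (ξ η : Tight S) where
  elt : X ≃. X
  mem : elt ∈ S
  dom_mem : star elt * elt ∈ ξ.carrier
  act_eq : act S elt ξ.carrier = η.carrier

namespace PreGerm

/-- `(s, ξ) ∼ (t, ξ)` iff `se = te` for some idempotent `e ∈ ξ`. -/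
instance germSetoid (ξ η : Tight S) : Setoid (PreGerm ξ η) where
  r p q := ∃ e ∈ ξ.carrier, p.elt * e = q.elt * e
  iseqv :=
    { refl := fun _ => ⟨_, ξ.isFilter.nonempty.some_mem, rfl⟩
      symm := fun ⟨e, he, h⟩ => ⟨e, he, h.symm⟩
      trans := fun {p q r} ⟨e, he, h⟩ ⟨f, hf, h'⟩ => by
        refine ⟨e * f, ξ.isFilter.mul_mem he hf, ?_⟩
        have hc := idem_comm (ξ.isFilter.subset_idem he).2 (ξ.isFilter.subset_idem hf).2
        rw [← mul_assoc, h, mul_assoc, hc, ← mul_assoc, h', mul_assoc] }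

theorem rel_def {ξ η : Tight S} {p q : PreGerm ξ η} :
    p ≈ q ↔ ∃ e ∈ ξ.carrier, p.elt * e = q.elt * e := Iff.rfl

/-- The unit at `ξ`, represented by any idempotent of `ξ`. -/
def one (ξ : Tight S) : PreGerm ξ ξ where
  elt := ξ.isFilter.nonempty.some
  mem := (ξ.isFilter.subset_idem ξ.isFilter.nonempty.some_mem).1
  dom_mem := by
    have h := (ξ.isFilter.subset_idem ξ.isFilter.nonempty.some_mem).2
    rw [idem_star h, h]
    exact ξ.isFilter.nonempty.some_mem
  act_eq := act_idem ξ.isFilter ξ.isFilter.nonempty.some_mem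

theorem one_mem (ξ : Tight S) : (one ξ).elt ∈ ξ.carrier := ξ.isFilter.nonempty.some_mem

theorem dom_mem_of {ξ η : Tight S} (p : PreGerm ξ η) {f : X ≃. X} (hf : f ∈ η.carrier) :
    ∃ g ∈ ξ.carrier, IdemLE (p.elt * g * star p.elt) f := by
  rw [← p.act_eq] at hf
  exact hf.2

/-- `(t, η)(s, ξ) = (ts, ξ)` when `s · ξ = η`. -/
def comp {ξ η ζ : Tight S} (p : PreGerm ξ η) (q : PreGerm η ζ) : PreGerm ξ ζ where
  elt := q.elt * p.elt
  mem := smul_mem q.mem p.mem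
  dom_mem := by
    obtain ⟨g, hg, hle⟩ := p.dom_mem_of q.dom_mem
    have hgi := ξ.isFilter.subset_idem hg
    have h := conj_mono (sstar_mem p.mem) (conj_idem p.mem hgi) hle
    rw [star_star] at h
    have h1 : star p.elt * (p.elt * g * star p.elt) * p.elt ∈ ξ.carrier := by
      have := ξ.isFilter.mul_mem (ξ.isFilter.mul_mem p.dom_mem hg) p.dom_mem
      simpa only [mul_assoc] using this
    have h2 := ξ.isFilter.mem_of_le h1 (by
      simpa using conj_idem (sstar_mem p.mem) (star_mul_self_idem q.mem)) h
    rw [star_mul]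
    simpa only [mul_assoc] using h2
  act_eq := by rw [act_mul ξ.isFilter p.mem q.mem, p.act_eq, q.act_eq]

/-- `(s, ξ)⁻¹ = (s*, s · ξ)`. -/
def inv {ξ η : Tight S} (p : PreGerm ξ η) : PreGerm η ξ where
  elt := star p.elt
  mem := sstar_mem p.mem
  dom_mem := by
    have h := conj_mem_act ξ.isFilter p.mem p.dom_mem
    rw [p.act_eq, ← mul_assoc, mul_star_mul] at h
    simpa using h
  act_eq := by
    rw [← p.act_eq, ← act_mul ξ.isFilter p.mem (sstar_mem p.mem)]
    exact act_idem ξ.isFilter p.dom_mem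

theorem equiv_of_mem {ξ : Tight S} {p q : PreGerm ξ ξ} (hp : p.elt ∈ ξ.carrier)
    (hq : q.elt ∈ ξ.carrier) : p ≈ q := by
  refine ⟨p.elt * q.elt, ξ.isFilter.mul_mem hp hq, ?_⟩
  have h1 := (ξ.isFilter.subset_idem hp).2
  have h2 := (ξ.isFilter.subset_idem hq).2
  rw [← mul_assoc, h1, idem_comm h1 h2, ← mul_assoc, h2]

theorem one_comp {ξ η : Tight S} (p : PreGerm ξ η) : (one ξ).comp p ≈ p := by
  refine ⟨(one ξ).elt, one_mem ξ, ?_⟩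
  change p.elt * (one ξ).elt * (one ξ).elt = _
  rw [mul_assoc, (ξ.isFilter.subset_idem (one_mem ξ)).2]

/-- If `s g s* ≤ f`, then `f` fixes `s g s*s` on the left. -/
theorem absorb {s g f : X ≃. X} (hs : s ∈ S) (hg : g ∈ Idem S) (hf : f ∈ Idem S)
    (h : IdemLE (s * g * star s) f) : f * (s * (g * (star s * s))) = s * (g * (star s * s)) := by
  have h' : f * (s * g * star s) = s * g * star s := by
    rw [idem_comm hf.2 (conj_idem hs hg).2]
    exact h.symm
  have := congrArg (· * s) h'
  simpa only [mul_assoc] using this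

theorem comp_one {ξ η : Tight S} (p : PreGerm ξ η) : p.comp (one η) ≈ p := by
  obtain ⟨g, hg, hle⟩ := p.dom_mem_of (one_mem η)
  refine ⟨g * (star p.elt * p.elt), ξ.isFilter.mul_mem hg p.dom_mem, ?_⟩
  change (one η).elt * p.elt * _ = _
  rw [mul_assoc]
  exact absorb p.mem (ξ.isFilter.subset_idem hg) (η.isFilter.subset_idem (one_mem η)) hle

theorem comp_congr {ξ η ζ : Tight S} {p p' : PreGerm ξ η} {q q' : PreGerm η ζ}
    (hp : p ≈ p') (hq : q ≈ q') : p.comp q ≈ p'.comp q' := by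
  obtain ⟨e, he, hpe⟩ := hp
  obtain ⟨f, hf, hqf⟩ := hq
  obtain ⟨g, hg, hle⟩ := p.dom_mem_of hf
  have hd := ξ.isFilter.mul_mem hg p.dom_mem
  have hab := absorb p.mem (ξ.isFilter.subset_idem hg) (η.isFilter.subset_idem hf) hle
  refine ⟨g * (star p.elt * p.elt) * e, ξ.isFilter.mul_mem hd he, ?_⟩
  change q.elt * p.elt * _ = q'.elt * p'.elt * _
  have h1 : q.elt * (p.elt * (g * (star p.elt * p.elt)))
      = q'.elt * (p.elt * (g * (star p.elt * p.elt))) := by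
    rw [← hab, ← mul_assoc q.elt f, hqf, mul_assoc q'.elt f]
  have h2 : p.elt * (g * (star p.elt * p.elt) * e) = p'.elt * (g * (star p.elt * p.elt) * e) := by
    rw [idem_comm (ξ.isFilter.subset_idem hd).2 (ξ.isFilter.subset_idem he).2, ← mul_assoc, hpe,
      mul_assoc]
  calc q.elt * p.elt * (g * (star p.elt * p.elt) * e)
      = q.elt * (p.elt * (g * (star p.elt * p.elt))) * e := by simp only [mul_assoc]
    _ = q'.elt * (p.elt * (g * (star p.elt * p.elt) * e)) := by rw [h1]; simp only [mul_assoc]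
    _ = q'.elt * p'.elt * (g * (star p.elt * p.elt) * e) := by rw [h2]; simp only [mul_assoc]

theorem inv_congr {ξ η : Tight S} {p q : PreGerm ξ η} (h : p ≈ q) : p.inv ≈ q.inv := by
  obtain ⟨e, he, hpq⟩ := h
  have hei := ξ.isFilter.subset_idem he
  have key : ∀ r : PreGerm ξ η, star r.elt * (r.elt * e * star r.elt) = star (r.elt * e) := by
    intro r
    calc star r.elt * (r.elt * e * star r.elt)
        = (star r.elt * r.elt) * e * star r.elt := by simp only [mul_assoc]
      _ = e * (star r.elt * r.elt) * star r.elt := by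
          rw [idem_comm (star_mul_self_idem r.mem).2 hei.2]
      _ = e * (star r.elt * star (star r.elt) * star r.elt) := by
          rw [star_star]; simp only [mul_assoc]
      _ = star (r.elt * e) := by rw [mul_star_mul, star_mul, idem_star hei.2]
  have hconj : ∀ r : PreGerm ξ η, r.elt * e * star r.elt = (r.elt * e) * star (r.elt * e) := by
    intro r
    rw [star_mul, idem_star hei.2, mul_assoc, mul_assoc, ← mul_assoc e e, hei.2]
  refine ⟨p.elt * e * star p.elt, ?_, ?_⟩
  · rw [← p.act_eq]
    exact conj_mem_act ξ.isFilter p.mem he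
  · change star p.elt * _ = star q.elt * _
    rw [key p, hconj p, hpq, ← hconj q, key q]

end PreGerm

/-- The tight groupoid of `S`: the groupoid of germs `[s, ξ]` of the action of `S` on its tight
filters. The units are the tight filters, and `[s, ξ]` is an arrow from `ξ` to `s · ξ`. Note that
`f ≫ g` in Mathlib's order is the groupoid product `g f`. -/
instance tightGroupoid (S : InverseSubsemigroup X) : Groupoid (Tight S) where
  Hom ξ η := Quotient (PreGerm.germSetoid ξ η)
  id ξ := Quotient.mk _ (PreGerm.one ξ)
  comp := Quotient.map₂ PreGerm.comp fun _ _ hp _ _ hq => PreGerm.comp_congr hp hq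
  inv := Quotient.map PreGerm.inv fun _ _ h => PreGerm.inv_congr h
  id_comp := by
    rintro ξ η ⟨p⟩
    exact Quotient.sound (PreGerm.one_comp p)
  comp_id := by
    rintro ξ η ⟨p⟩
    exact Quotient.sound (PreGerm.comp_one p)
  assoc := by
    rintro ξ η ζ θ ⟨p⟩ ⟨q⟩ ⟨r⟩
    refine Quotient.sound ⟨_, ξ.isFilter.nonempty.some_mem, ?_⟩
    change r.elt * (q.elt * p.elt) * _ = (r.elt * q.elt) * p.elt * _
    simp only [mul_assoc]
  inv_comp := by
    rintro ξ η ⟨p⟩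
    refine Quotient.sound (PreGerm.equiv_of_mem ?_ (PreGerm.one_mem η))
    simpa [PreGerm.inv, PreGerm.comp] using p.inv.dom_mem
  comp_inv := by
    rintro ξ η ⟨p⟩
    exact Quotient.sound (PreGerm.equiv_of_mem p.dom_mem (PreGerm.one_mem ξ))

end SymmetricInverse

/-! ### Minimal topological groupoids -/

/-- The type of all arrows of a groupoid. -/
def Arrows (G : Type*) [Groupoid G] : Type _ := Σ (x y : G), (x ⟶ y)

/-- The embedding of the unit space of a groupoid into its arrows. -/
def unitArrow {G : Type*} [Groupoid G] (x : G) : Arrows G := ⟨x, x, 𝟙 x⟩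

/-- A groupoid `G` with a topology on its arrows is minimal if the only open invariant subsets of
its unit space are the empty set and the whole unit space. The unit space carries the subspace
topology of the space of arrows. -/
def IsMinimal (G : Type*) [Groupoid G] [TopologicalSpace (Arrows G)] : Prop :=
  ∀ U : Set G, IsOpen[induced unitArrow inferInstance] U →
    (∀ x y : G, (x ⟶ y) → x ∈ U → y ∈ U) → U = ∅ ∨ U = Set.univ

section TightTopology

variable {X : Type w} (S : InverseSubsemigroup X)

/-- The set of germs `Θ(s, U) = {[s, ξ] : ξ ∈ U}`. -/
def Theta (s : X ≃. X) (U : Set (Tight S)) : Set (Arrows (Tight S)) :=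
  {a | ∃ (ξ η : Tight S) (p : PreGerm ξ η), ξ ∈ U ∧ p.elt = s ∧ a = ⟨ξ, η, Quotient.mk _ p⟩}

/-- The topology of the tight groupoid, generated by the sets `Θ(s, U)` with `s ∈ S` and `U` an
open set of tight filters contained in the domain of `s`. -/
instance : TopologicalSpace (Arrows (Tight S)) :=
  generateFrom {V | ∃ (s : X ≃. X) (U : Set (Tight S)), s ∈ S ∧ IsOpen U ∧
    (∀ ξ ∈ U, star s * s ∈ ξ.carrier) ∧ V = Theta S s U}

theorem isOpen_mem {e : X ≃. X} (he : e ∈ Idem S) : IsOpen {ξ : Tight S | e ∈ ξ.carrier} := by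
  have h : IsOpen {η : Filt S | e ∈ η.1} := by
    apply isOpen_generateFrom_of_mem
    refine ⟨{e}, ∅, Set.finite_singleton _, Set.finite_empty, by simpa using he, by simp, ?_⟩
    ext η
    simp
  exact h.preimage continuous_subtype_val

/-- The topology of the unit space of the tight groupoid is the topology of the space of tight
filters. -/
theorem induced_unitArrow :
    induced (unitArrow (G := Tight S)) inferInstance = (inferInstance : TopologicalSpace (Tight S)) := by
  apply le_antisymm
  · intro U hU
    have hU' : IsOpen[induced (unitArrow (G := Tight S)) inferInstance]
        (⋃ e ∈ Idem S, unitArrow ⁻¹' (Theta S e (U ∩ {ξ | e ∈ ξ.carrier}))) := by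
      refine @isOpen_biUnion _ _ (induced _ _) _ _ fun e he => ?_
      refine isOpen_induced_iff.2 ⟨_, ?_, rfl⟩
      apply isOpen_generateFrom_of_mem
      refine ⟨e, _, he.1, hU.inter (isOpen_mem S he), ?_, rfl⟩
      rintro ξ ⟨-, hξ⟩
      rw [idem_star he.2, he.2]
      exact hξ
    convert hU'
    ext ξ
    simp only [Set.mem_iUnion, Set.mem_preimage]
    constructor
    · intro hξ
      refine ⟨(PreGerm.one ξ).elt, ξ.isFilter.subset_idem (PreGerm.one_mem ξ), ξ, ξ,
        PreGerm.one ξ, ⟨hξ, PreGerm.one_mem ξ⟩, rfl, rfl⟩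
    · rintro ⟨e, -, ξ', η, p, hξ', -, h⟩
      have : ξ = ξ' := congrArg Sigma.fst h
      rw [this]
      exact hξ'.1
  · rw [← continuous_iff_le_induced]
    refine continuous_generateFrom_iff.2 ?_
    rintro V ⟨s, U, hs, hU, hdom, rfl⟩
    have : unitArrow ⁻¹' (Theta S s U)
        = U ∩ ⋃ e ∈ {e | e ∈ Idem S ∧ s * e = e}, {ξ : Tight S | e ∈ ξ.carrier} := by
      ext ξ
      simp only [Set.mem_preimage, Set.mem_inter_iff, Set.mem_iUnion, Set.mem_ofPred_eq]
      constructor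
      · rintro ⟨ξ', η, p, hξ', rfl, h⟩
        obtain rfl : ξ = ξ' := congrArg Sigma.fst h
        have h2 := eq_of_heq (Sigma.mk.inj h).2
        obtain rfl : ξ = η := congrArg Sigma.fst h2
        have h3 := eq_of_heq (Sigma.mk.inj h2).2
        obtain ⟨e, he, h4⟩ := Quotient.exact h3
        have hoi := ξ.isFilter.subset_idem (PreGerm.one_mem ξ)
        have hei := ξ.isFilter.subset_idem he
        have hm := ξ.isFilter.mul_mem (PreGerm.one_mem ξ) he
        refine ⟨hξ', _, ⟨ξ.isFilter.subset_idem hm, ?_⟩, hm⟩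
        rw [idem_comm hoi.2 hei.2, ← mul_assoc, ← h4, mul_assoc, idem_comm hei.2 hoi.2,
          ← mul_assoc, hoi.2]
      · rintro ⟨hξ, e, ⟨hei, hse⟩, he⟩
        have hact : act S s ξ.carrier = ξ.carrier := by
          have hse' : e * star s = e := by
            have := congrArg star hse
            rwa [star_mul, idem_star hei.2] at this
          conv_rhs => rw [← act_idem ξ.isFilter he]
          ext f
          constructor
          · rintro ⟨hf, g, hg, hle⟩
            have hgi := ξ.isFilter.subset_idem hg
            refine ⟨hf, e * g * e, ξ.isFilter.mul_mem (ξ.isFilter.mul_mem he hg) he, ?_⟩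
            have hg2 : IdemLE (e * g * e) g := by
              unfold IdemLE
              rw [mul_assoc, mul_assoc, mul_assoc, idem_comm hei.2 hgi.2, ← mul_assoc g g, hgi.2]
            have := idemLE_trans (conj_mono hs
              (idem_mul (idem_mul hei hgi) hei) hg2) hle
            have h5 : s * (e * g * e) * star s = e * (e * g * e) * star e := by
              rw [idem_star hei.2]
              calc s * (e * g * e) * star s = (s * e) * g * (e * star s) := by
                    simp only [mul_assoc]
                _ = e * g * e := by rw [hse, hse']
                _ = (e * e) * g * (e * e) := by rw [hei.2]
                _ = _ := by simp only [mul_assoc]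
            rwa [h5] at this
          · intro hf
            rw [act_idem ξ.isFilter he] at hf
            have hfi := ξ.isFilter.subset_idem hf
            refine ⟨hfi, e * f * e, ξ.isFilter.mul_mem (ξ.isFilter.mul_mem he hf) he, ?_⟩
            have h5 : s * (e * f * e) * star s = e * f * e := by
              calc s * (e * f * e) * star s = (s * e) * f * (e * star s) := by
                    simp only [mul_assoc]
                _ = e * f * e := by rw [hse, hse']
            rw [h5]
            unfold IdemLE
            rw [mul_assoc, mul_assoc, mul_assoc, idem_comm hei.2 hfi.2, ← mul_assoc f f, hfi.2]
        refine ⟨ξ, ξ, ⟨s, hs, hdom ξ hξ, hact⟩, hξ, rfl, ?_⟩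
        have : (𝟙 ξ : ξ ⟶ ξ) = Quotient.mk _ (⟨s, hs, hdom ξ hξ, hact⟩ : PreGerm ξ ξ) := by
          refine Quotient.sound ⟨(PreGerm.one ξ).elt * e, ξ.isFilter.mul_mem (PreGerm.one_mem ξ) he, ?_⟩
          have hoi := ξ.isFilter.subset_idem (PreGerm.one_mem ξ)
          change (PreGerm.one ξ).elt * _ = s * _
          rw [← mul_assoc, hoi.2, idem_comm hoi.2 hei.2, ← mul_assoc, hse]
        unfold unitArrow
        rw [this]
    rw [this]
    exact hU.inter (isOpen_biUnion fun e he => isOpen_mem S he.1)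

end TightTopology

/-! ### Left cancellative small categories -/

/-- A category is left cancellative if `αβ = αγ` implies `β = γ`. The product `αβ` of the paths
`α` and `β` is the composite `α ∘ β`, which is `β ≫ α` in Mathlib's order. -/
class LeftCancellative (C : Type u) [Category.{v} C] : Prop where
  left_cancel : ∀ {x y z : C} (α : y ⟶ z) (β γ : x ⟶ y), β ≫ α = γ ≫ α → β = γ

/-- The set `Λ` of all morphisms of a category; `dom` is the source `s` and `cod` the range `r`. -/
structure Mor (C : Type u) [Category.{v} C] where
  {dom cod : C}
  hom : dom ⟶ cod

section Paths

variable {C : Type u} [Category.{v} C]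

/-- The set `αΛ = {αβ : β ∈ Λ, r(β) = s(α)}`. -/
def extensions (α : Mor C) : Set (Mor C) :=
  {γ | ∃ (x : C) (β : x ⟶ α.dom), γ = ⟨β ≫ α.hom⟩}

/-- `α ⋓ β`, i.e. `αΛ ∩ βΛ ≠ ∅`. -/
def Meets (α β : Mor C) : Prop := (extensions α ∩ extensions β).Nonempty

variable (C) in
/-- Finite alignment: each `αΛ ∩ βΛ` is a finite union of sets `γΛ`. -/
def FinitelyAligned : Prop :=
  ∀ α β : Mor C, ∃ Γ : Finset (Mor C), extensions α ∩ extensions β = ⋃ γ ∈ Γ, extensions γ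

/-- `F ∈ FE(α)`: `F` is a finite subset of `r(α)Λ` and every `γ ∈ αΛ` satisfies `β ⋓ γ` for some
`β ∈ F`. -/
def IsFiniteExhaustive (α : Mor C) (F : Finset (Mor C)) : Prop :=
  (∀ β ∈ F, β.cod = α.cod) ∧ ∀ γ ∈ extensions α, ∃ β ∈ F, Meets β γ

/-- The underlying partial function of `τ^α`: it sends `β ∈ s(α)Λ` to `αβ`. -/
def tauFun (α β : Mor C) : Option (Mor C) :=
  open Classical in
  if h : β.cod = α.dom then some ⟨β.hom ≫ eqToHom h ≫ α.hom⟩ else none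

theorem mem_tauFun {α β γ : Mor C} :
    γ ∈ tauFun α β ↔ ∃ (x : C) (g : x ⟶ α.dom), β = ⟨g⟩ ∧ γ = ⟨g ≫ α.hom⟩ := by
  constructor
  · intro h
    obtain ⟨b⟩ := β
    by_cases hc : Mor.cod ⟨b⟩ = α.dom
    · refine ⟨_, b ≫ eqToHom hc, ?_, ?_⟩
      · obtain ⟨a⟩ := α
        dsimp at hc
        subst hc
        simp
      · simp only [tauFun, dif_pos hc, Option.mem_def, Option.some.injEq] at h
        rw [← h, Category.assoc]
    · simp [tauFun, hc] at h
  · rintro ⟨x, g, rfl, rfl⟩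
    simp [tauFun]

theorem tauFun_inj [LeftCancellative C] {α β β' γ : Mor C} (h : γ ∈ tauFun α β)
    (h' : γ ∈ tauFun α β') : β = β' := by
  obtain ⟨x, g, rfl, rfl⟩ := mem_tauFun.1 h
  obtain ⟨x', g', rfl, h2⟩ := mem_tauFun.1 h'
  simp only [Mor.mk.injEq] at h2
  obtain ⟨rfl, -, h3⟩ := h2
  rw [LeftCancellative.left_cancel _ _ _ (eq_of_heq h3)]

/-- The partial bijection `τ^α : s(α)Λ → αΛ`, `β ↦ αβ`. -/
def tau [LeftCancellative C] (α : Mor C) : Mor C ≃. Mor C where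
  toFun := tauFun α
  invFun γ := open Classical in if h : ∃ β, γ ∈ tauFun α β then some h.choose else none
  inv β γ := by
    split_ifs with h
    · constructor
      · intro h'
        rw [Option.some.injEq] at h'
        rw [← h']
        exact h.choose_spec
      · intro h'
        rw [tauFun_inj h.choose_spec h']
    · simp only [false_iff]
      exact fun h' => h ⟨β, h'⟩

/-- The partial bijection `σ^α : αΛ → s(α)Λ`, `αβ ↦ β`. -/
def sigma [LeftCancellative C] (α : Mor C) : Mor C ≃. Mor C := (tau α).symm

theorem mem_tau [LeftCancellative C] {α β γ : Mor C} :
    γ ∈ tau α β ↔ ∃ (x : C) (g : x ⟶ α.dom), β = ⟨g⟩ ∧ γ = ⟨g ≫ α.hom⟩ := mem_tauFun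

theorem mem_sigma [LeftCancellative C] {α β γ : Mor C} :
    β ∈ sigma α γ ↔ ∃ (x : C) (g : x ⟶ α.dom), β = ⟨g⟩ ∧ γ = ⟨g ≫ α.hom⟩ :=
  (PEquiv.mem_iff_mem _).trans mem_tau

variable (C) in
/-- The inverse semigroup `S_Λ`, generated in `Inv(Λ)` by all `σ^α` and `τ^α`. -/
def SLambda [LeftCancellative C] : InverseSubsemigroup (Mor C) where
  toSubsemigroup :=
    Subsemigroup.closure (Set.range (sigma : Mor C → Mor C ≃. Mor C) ∪ Set.range tau)
  star_mem' := by
    intro s hs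
    change s ∈ Subsemigroup.closure _ at hs
    change star s ∈ Subsemigroup.closure _
    induction hs using Subsemigroup.closure_induction with
    | mem x hx =>
      apply Subsemigroup.subset_closure
      rcases hx with ⟨α, rfl⟩ | ⟨α, rfl⟩
      · exact Or.inr ⟨α, rfl⟩
      · exact Or.inl ⟨α, rfl⟩
    | mul x y hx hy ihx ihy =>
      rw [star_mul]
      exact Subsemigroup.mul_mem _ ihy ihx

end Paths

end LCSC

end

open LCSC

/-! The equivalence of minimality with the outer cover condition holds for every inverse semigroup
`S` of partial bijections (`isMinimal_tight_iff`). Given a nonzero idempotent `f`, the tight filters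
containing some conjugate `s f s*` form a nonempty open invariant set. If no finite family of these
conjugates is an outer cover for `e`, compactness (`exists_tight_disjoint`) yields a tight filter
through `e` outside this set, so the groupoid is not minimal. Conversely, a nonempty open set
contains all tight filters through some nonzero `f` (`exists_idem_subset`). A tight filter `η`
containing `e` meets every finite outer cover of `e` (`exists_mem_of_isOuterCoverOf`). So some `s f
s*` lies in `η`, the filter `s* · η` contains `f`, and invariance brings `η` into the open set.

The translation to paths (`outerCover_iff_exhaustive`) rests on two facts about elements of `S_Λ`:
they commute with right multiplication, hence preserve sources, and by finite alignment their
domains are finite unions of sets `κΛ`. From outer covers, take `e = τ^α σ^α` and `f = σ^β τ^β`; the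
generators `κ` of the domains of the `s_i f s_i*` with range `r(α)` form the exhaustive set, and
`s_i*` carries such a `κ` into `s(β)Λ s(κ)`. From exhaustive sets, if `f` fixes `β` and `δ ∈ s(β)Λ
s(γ)`, then conjugating `f` by `τ^γ σ^{βδ}` gives an idempotent fixing `γ`, hence all of `γΛ`. -/

namespace LCSC

/-! ### Idempotents and the action on filters -/

section Filters

variable {X : Type w} {S : InverseSubsemigroup X}

theorem mem_fix_mul {e f : X ≃. X} {a : X} (he : a ∈ e a) (hf : a ∈ f a) : a ∈ (e * f) a :=
  mem_mul.2 ⟨a, hf, he⟩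

theorem exists_mem_of_ne_bot {s : X ≃. X} (h : s ≠ ⊥) : ∃ a b, b ∈ s a := by
  by_contra! hc
  refine h (ext_mem fun a b => ⟨fun hb => (hc a b hb).elim, fun hb => ?_⟩)
  simp at hb

theorem ne_bot_of_mem {s : X ≃. X} {a b : X} (h : b ∈ s a) : s ≠ ⊥ := by
  rintro rfl
  simp at h

theorem bot_mul' (s : X ≃. X) : (⊥ : X ≃. X) * s = ⊥ := PEquiv.trans_bot s

theorem mul_bot' (s : X ≃. X) : s * (⊥ : X ≃. X) = ⊥ := PEquiv.bot_trans s

theorem mem_mul_fix {e f : X ≃. X} (hf : f * f = f) {a b : X}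
    (h : b ∈ (e * f) a) : b ∈ e a ∧ a ∈ f a := by
  obtain ⟨c, hc, hb⟩ := mem_mul.1 h
  obtain rfl := idem_fix hf hc
  exact ⟨hb, hc⟩

theorem idemLE_iff {e f : X ≃. X} (he : e * e = e) (hf : f * f = f) :
    IdemLE e f ↔ ∀ a, a ∈ e a → a ∈ f a := by
  constructor
  · intro h a ha
    rw [h] at ha
    obtain ⟨b, hb, -⟩ := mem_mul.1 ha
    obtain rfl := idem_fix hf hb
    exact hb
  · intro h
    refine ext_mem fun a b => ⟨fun hb => ?_, fun hb => ?_⟩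
    · obtain rfl := idem_fix he hb
      exact mem_fix_mul hb (h _ hb)
    · exact (mem_mul_fix hf hb).1

theorem mul_idemLE_left {e f : X ≃. X} (he : e ∈ Idem S) (hf : f ∈ Idem S) :
    IdemLE (e * f) e := by
  unfold IdemLE
  rw [idem_comm he.2 hf.2, mul_assoc, he.2]

theorem mul_idemLE_right {e f : X ≃. X} (hf : f ∈ Idem S) :
    IdemLE (e * f) f := by
  unfold IdemLE
  rw [mul_assoc, hf.2]

theorem star_conj_idem {s f : X ≃. X} (hs : s ∈ S) (hf : f ∈ Idem S) :
    star s * f * s ∈ Idem S := by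
  simpa using conj_idem (sstar_mem hs) hf

/-- Since `s (s* f s) s* = f s s* ≤ f`, the element `s* f s` is a canonical witness. The existential
in `act` becomes one membership condition, so the failure of membership is pulled back along `s` as
well. -/
theorem mem_act_iff {η : Set (X ≃. X)} (hη : IsFilter S η) {s f : X ≃. X} (hs : s ∈ S)
    (hd : star s * s ∈ η) : f ∈ act S s η ↔ f ∈ Idem S ∧ star s * f * s ∈ η := by
  constructor
  · rintro ⟨hf, e, he, hle⟩
    have hei := hη.subset_idem he
    refine ⟨hf, hη.mem_of_le (hη.mul_mem (hη.mul_mem hd he) hd) (star_conj_idem hs hf) ?_⟩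
    have := conj_mono (sstar_mem hs) (conj_idem hs hei) hle
    simpa only [star_star, mul_assoc] using this
  · rintro ⟨hf, h⟩
    refine ⟨hf, _, h, ?_⟩
    have hr := self_mul_star_idem (S := S) hs
    have : s * (star s * f * s) * star s = f * (s * star s) := by
      calc s * (star s * f * s) * star s = ((s * star s) * f) * (s * star s) := by
            simp only [mul_assoc]
        _ = f * (s * star s) := by rw [idem_comm hr.2 hf.2, mul_assoc f, hr.2]
    rw [this]
    exact mul_idemLE_left hf hr

theorem act_mono (s : X ≃. X) {η ζ : Set (X ≃. X)} (h : η ⊆ ζ) : act S s η ⊆ act S s ζ :=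
  fun _ ⟨hf, e, he, hle⟩ => ⟨hf, e, h he, hle⟩

theorem isFilter_act {η : Set (X ≃. X)} (hη : IsFilter S η) {s : X ≃. X} (hs : s ∈ S)
    (hd : star s * s ∈ η) : IsFilter S (act S s η) where
  subset_idem := fun _ h => h.1
  nonempty := ⟨_, conj_mem_act hη hs hd⟩
  bot_notMem := fun h => by
    have := ((mem_act_iff hη hs hd).1 h).2
    rw [mul_bot', bot_mul'] at this
    exact hη.bot_notMem this
  mem_of_le := fun ⟨_, g, hg, hle⟩ hf h => ⟨hf, g, hg, idemLE_trans hle h⟩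
  mul_mem := fun {e f} he hf => by
    rw [mem_act_iff hη hs hd] at he hf ⊢
    refine ⟨idem_mul he.1 hf.1, ?_⟩
    have := hη.mul_mem he.2 hf.2
    have h2 : star s * e * s * (star s * f * s) = star s * (e * f) * s := by
      calc star s * e * s * (star s * f * s) = star s * (e * (s * star s)) * f * s := by
            simp only [mul_assoc]
        _ = star s * ((s * star s) * e) * f * s := by
            rw [idem_comm he.1.2 (self_mul_star_idem hs).2]
        _ = (star s * star (star s) * star s) * e * f * s := by
            simp only [mul_assoc, star_star]
        _ = _ := by rw [mul_star_mul]; simp only [mul_assoc]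
    rwa [h2] at this

theorem range_mem_act {η : Set (X ≃. X)} (hη : IsFilter S η) {s : X ≃. X} (hs : s ∈ S)
    (hd : star s * s ∈ η) : s * star s ∈ act S s η := by
  have h := conj_mem_act hη hs hd
  rwa [← mul_assoc, mul_star_mul] at h

theorem act_star_act {η : Set (X ≃. X)} (hη : IsFilter S η) {s : X ≃. X} (hs : s ∈ S)
    (hd : star s * s ∈ η) : act S (star s) (act S s η) = η := by
  rw [← act_mul hη hs (sstar_mem hs)]
  exact act_idem hη hd

/-- The filter `s · η`. -/
def Filt.act (s : X ≃. X) (hs : s ∈ S) (η : Filt S) (hd : star s * s ∈ η.1) : Filt S :=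
  ⟨LCSC.act S s η.1, isFilter_act η.2 hs hd⟩

/-- A filter above `s · η` is carried by `s*` to a filter above `η`, which equals `η` by maximality;
applying `s` again gives the claim. -/
theorem act_mem_ultra {s : X ≃. X} (hs : s ∈ S) {η : Filt S} (hd : star s * s ∈ η.1)
    (hη : η ∈ Ultra S) : η.act s hs hd ∈ Ultra S := by
  intro θ hθ
  have hr : s * star s ∈ θ.1 := hθ (range_mem_act η.2 hs hd)
  have hr' : star (star s) * star s ∈ θ.1 := by rwa [star_star]
  have h := hη (θ.act (star s) (sstar_mem hs) hr') (by
    have := act_mono (S := S) (star s) hθ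
    change act S (star s) (act S s η.1) ⊆ _ at this
    rwa [act_star_act η.2 hs hd] at this)
  refine Subtype.ext ?_
  have h1 : act S (star s) θ.1 = η.1 := congrArg Subtype.val h
  have h2 := act_star_act θ.2 (sstar_mem hs) hr'
  rw [star_star, h1] at h2
  exact h2.symm

/-! ### Basic neighbourhoods and tight filters -/

theorem isOpen_basic {A B : Set (X ≃. X)} (hA : A.Finite) (hB : B.Finite) (hA' : A ⊆ Idem S)
    (hB' : B ⊆ Idem S) : IsOpen {η : Filt S | A ⊆ η.1 ∧ B ∩ η.1 = ∅} :=
  isOpen_generateFrom_of_mem ⟨A, B, hA, hB, hA', hB', rfl⟩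

/-- The sets defined by finitely many conditions form a basis of the topology. -/
theorem exists_basic_subset {U : Set (Filt S)} (hU : IsOpen U) {η : Filt S} (hη : η ∈ U) :
    ∃ A B : Set (X ≃. X), A.Finite ∧ B.Finite ∧ A ⊆ Idem S ∧ B ⊆ Idem S ∧
      A ⊆ η.1 ∧ B ∩ η.1 = ∅ ∧ {ζ : Filt S | A ⊆ ζ.1 ∧ B ∩ ζ.1 = ∅} ⊆ U := by
  induction hU with
  | basic U h =>
    obtain ⟨A, B, hA, hB, hA', hB', rfl⟩ := h
    exact ⟨A, B, hA, hB, hA', hB', hη.1, hη.2, subset_rfl⟩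
  | univ =>
    exact ⟨∅, ∅, by simp, by simp, by simp, by simp, by simp, by simp, by simp⟩
  | inter U V _ _ ihU ihV =>
    obtain ⟨A, B, hA, hB, hA', hB', h1, h2, h3⟩ := ihU hη.1
    obtain ⟨A₁, B₁, hA₁, hB₁, hA₁', hB₁', k1, k2, k3⟩ := ihV hη.2
    refine ⟨A ∪ A₁, B ∪ B₁, hA.union hA₁, hB.union hB₁, Set.union_subset hA' hA₁',
      Set.union_subset hB' hB₁', Set.union_subset h1 k1, ?_, ?_⟩
    · rw [Set.union_inter_distrib_right, h2, k2, Set.union_empty]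
    · rintro ζ ⟨hz1, hz2⟩
      rw [Set.union_inter_distrib_right, Set.union_empty_iff] at hz2
      rw [Set.union_subset_iff] at hz1
      exact ⟨h3 ⟨hz1.1, hz2.1⟩, k3 ⟨hz1.2, hz2.2⟩⟩
  | sUnion 𝒰 _ ih =>
    obtain ⟨U, hU, hηU⟩ := hη
    obtain ⟨A, B, hA, hB, hA', hB', h1, h2, h3⟩ := ih U hU hηU
    exact ⟨A, B, hA, hB, hA', hB', h1, h2, h3.trans (Set.subset_sUnion_of_mem hU)⟩

theorem exists_ultra_of_tight {η : Filt S} (hη : η ∈ closure (Ultra S)) {A B : Set (X ≃. X)}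
    (hA : A.Finite) (hB : B.Finite) (hB' : B ⊆ Idem S) (h1 : A ⊆ η.1) (h2 : B ∩ η.1 = ∅) :
    ∃ ζ ∈ Ultra S, A ⊆ ζ.1 ∧ B ∩ ζ.1 = ∅ := by
  obtain ⟨ζ, hζ, hu⟩ := mem_closure_iff.1 hη _
    (isOpen_basic hA hB (h1.trans η.2.subset_idem) hB') ⟨h1, h2⟩
  exact ⟨ζ, hu, hζ⟩

/-- The action is continuous and preserves maximal filters, so it preserves their closure. -/
theorem act_mem_tight {s : X ≃. X} (hs : s ∈ S) {η : Filt S} (hd : star s * s ∈ η.1)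
    (hη : η ∈ closure (Ultra S)) : η.act s hs hd ∈ closure (Ultra S) := by
  refine mem_closure_iff.2 fun U hU hmem => ?_
  obtain ⟨A, B, hA, hB, hA', hB', h1, h2, h3⟩ := exists_basic_subset hU hmem
  -- The conditions at `s · η` are pulled back to `η` by `f ↦ s* f s`; adding `s* s` keeps `ζ` in
  -- the domain of `s`.
  obtain ⟨ζ, hζ, hz1, hz2⟩ := exists_ultra_of_tight hη
    (A := insert (star s * s) ((fun f => star s * f * s) '' A))
    (B := (fun f => star s * f * s) '' B) ((hA.image _).insert _) (hB.image _)
    (by rintro _ ⟨f, hf, rfl⟩; exact star_conj_idem hs (hB' hf))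
    (by
      rintro _ (rfl | ⟨f, hf, rfl⟩)
      · exact hd
      · exact ((mem_act_iff η.2 hs hd).1 (h1 hf)).2)
    (by
      rw [Set.eq_empty_iff_forall_notMem] at h2 ⊢
      rintro _ ⟨⟨f, hf, rfl⟩, hf'⟩
      exact h2 f ⟨hf, (mem_act_iff η.2 hs hd).2 ⟨hB' hf, hf'⟩⟩)
  have hdz : star s * s ∈ ζ.1 := hz1 (Set.mem_insert _ _)
  refine ⟨ζ.act s hs hdz, h3 ⟨?_, ?_⟩, act_mem_ultra hs hdz hζ⟩
  · intro f hf
    exact (mem_act_iff ζ.2 hs hdz).2 ⟨hA' hf, hz1 (Or.inr ⟨f, hf, rfl⟩)⟩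
  · rw [Set.eq_empty_iff_forall_notMem] at hz2 ⊢
    rintro f ⟨hf, hf'⟩
    exact hz2 _ ⟨⟨f, hf, rfl⟩, ((mem_act_iff ζ.2 hs hdz).1 hf').2⟩

/-- The tight filter `s · η`. -/
def Tight.act (s : X ≃. X) (hs : s ∈ S) (η : Tight S) (hd : star s * s ∈ η.carrier) : Tight S :=
  ⟨η.1.act s hs hd, act_mem_tight hs hd η.2⟩

/-- The germ of `s` at `η`. -/
def Tight.germ (s : X ≃. X) (hs : s ∈ S) (η : Tight S) (hd : star s * s ∈ η.carrier) :
    η ⟶ η.act s hs hd :=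
  Quotient.mk _ ⟨s, hs, hd, rfl⟩

/-! ### Maximal filters, outer covers and compactness -/

/-- The filter of idempotents above a nonzero idempotent. -/
theorem isFilter_principal {e : X ≃. X} (he : e ∈ Idem S) (h0 : e ≠ ⊥) :
    IsFilter S {f | f ∈ Idem S ∧ IdemLE e f} where
  subset_idem := fun _ h => h.1
  nonempty := ⟨e, he, idemLE_refl he⟩
  bot_notMem := fun ⟨_, h⟩ => h0 (by unfold IdemLE at h; rwa [mul_bot'] at h)
  mem_of_le := fun h hf hle => ⟨hf, idemLE_trans h.2 hle⟩
  mul_mem := fun {f g} hf hg => ⟨idem_mul hf.1 hg.1, by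
    have h1 := hf.2
    have h2 := hg.2
    unfold IdemLE at *
    rw [← mul_assoc, ← h1, ← h2]⟩

theorem exists_ultra_superset (η : Filt S) : ∃ ζ ∈ Ultra S, η.1 ⊆ ζ.1 := by
  obtain ⟨m, hm, hmax⟩ := zorn_subset_nonempty {η : Set (X ≃. X) | IsFilter S η} (by
    intro c hc hchain ⟨y, hy⟩
    refine ⟨⋃₀ c, ?_, fun s hs => Set.subset_sUnion_of_mem hs⟩
    refine ⟨?_, ?_, ?_, ?_, ?_⟩
    · rintro f ⟨s, hs, hf⟩
      exact (hc hs).subset_idem hf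
    · obtain ⟨f, hf⟩ := (hc hy).nonempty
      exact ⟨f, y, hy, hf⟩
    · rintro ⟨s, hs, hf⟩
      exact (hc hs).bot_notMem hf
    · rintro e f ⟨s, hs, he⟩ hf hle
      exact ⟨s, hs, (hc hs).mem_of_le he hf hle⟩
    · rintro e f ⟨s, hs, he⟩ ⟨t, ht, hf⟩
      rcases hchain.total hs ht with h | h
      · exact ⟨t, ht, (hc ht).mul_mem (h he) hf⟩
      · exact ⟨s, hs, (hc hs).mul_mem he (h hf)⟩) η.1 η.2
  exact ⟨⟨m, hmax.prop⟩, fun ζ h => Subtype.ext (hmax.eq_of_subset ζ.2 h).symm, hm⟩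

theorem exists_ultra_mem {e : X ≃. X} (he : e ∈ Idem S) (h0 : e ≠ ⊥) :
    ∃ ζ ∈ Ultra S, e ∈ ζ.1 := by
  obtain ⟨ζ, hζ, h⟩ := exists_ultra_superset (⟨_, isFilter_principal he h0⟩ : Filt S)
  exact ⟨ζ, hζ, h ⟨he, idemLE_refl he⟩⟩

/-- An idempotent outside an ultrafilter is orthogonal to some element of the ultrafilter. -/
theorem exists_mul_eq_bot {ζ : Filt S} (hζ : ζ ∈ Ultra S) {b : X ≃. X} (hb : b ∈ Idem S)
    (hbz : b ∉ ζ.1) : ∃ a ∈ ζ.1, a * b = ⊥ := by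
  by_contra! h
  -- The filter generated by `ζ` and `b` is proper when no `a ∈ ζ` is orthogonal to `b`; maximality
  -- then forces `b ∈ ζ`.
  have hF : IsFilter S {f | f ∈ Idem S ∧ ∃ a ∈ ζ.1, IdemLE (a * b) f} := by
    refine ⟨fun _ h => h.1, ?_, ?_, ?_, ?_⟩
    · obtain ⟨a, ha⟩ := ζ.2.nonempty
      exact ⟨b, hb, a, ha, mul_idemLE_right hb⟩
    · rintro ⟨-, a, ha, hle⟩
      unfold IdemLE at hle
      rw [mul_bot'] at hle
      exact h a ha hle
    · rintro e f ⟨-, a, ha, hle⟩ hf hle'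
      exact ⟨hf, a, ha, idemLE_trans hle hle'⟩
    · rintro e f ⟨he, a, ha, hle⟩ ⟨hf, a', ha', hle'⟩
      refine ⟨idem_mul he hf, a * a', ζ.2.mul_mem ha ha', ?_⟩
      have hai := ζ.2.subset_idem ha
      have hai' := ζ.2.subset_idem ha'
      have hab := idem_mul hai hb
      have hab' := idem_mul hai' hb
      have h1 : a * a' * b = (a * b) * (a' * b) := by
        rw [mul_assoc a b, ← mul_assoc b a', idem_comm hb.2 hai'.2, mul_assoc a' b b, hb.2,
          mul_assoc]
      have h2 : IdemLE (a * a' * b) e := by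
        rw [h1]; exact idemLE_trans (mul_idemLE_left hab hab') hle
      have h3 : IdemLE (a * a' * b) f := by
        rw [h1]; exact idemLE_trans (mul_idemLE_right hab') hle'
      unfold IdemLE at *
      rw [← mul_assoc, ← h2, ← h3]
  have heq := hζ ⟨_, hF⟩ fun a ha =>
    ⟨ζ.2.subset_idem ha, a, ha, mul_idemLE_left (ζ.2.subset_idem ha) hb⟩
  obtain ⟨a, ha⟩ := ζ.2.nonempty
  refine hbz ?_
  rw [← heq]
  exact ⟨hb, a, ha, mul_idemLE_right hb⟩

theorem exists_mem_le_of_finite {η : Filt S} {A : Set (X ≃. X)} (hA : A.Finite) (h : A ⊆ η.1) :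
    ∃ g ∈ η.1, ∀ a ∈ A, IdemLE g a := by
  induction A, hA using Set.Finite.induction_on with
  | empty =>
    obtain ⟨g, hg⟩ := η.2.nonempty
    exact ⟨g, hg, by simp⟩
  | @insert a A _ _ ih =>
    obtain ⟨g, hg, hle⟩ := ih ((Set.subset_insert _ _).trans h)
    have ha := h (Set.mem_insert a A)
    have hai := η.2.subset_idem ha
    have hgi := η.2.subset_idem hg
    refine ⟨a * g, η.2.mul_mem ha hg, ?_⟩
    rintro b (rfl | hb)
    · exact mul_idemLE_left hai hgi
    · exact idemLE_trans (mul_idemLE_right hgi) (hle b hb)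

/-- An element of an ultrafilter which is orthogonal to finitely many idempotents outside it. -/
theorem exists_mem_orthogonal {ζ : Filt S} (hζ : ζ ∈ Ultra S) {A B : Set (X ≃. X)}
    (hA : A.Finite) (hB : B.Finite) (hB' : B ⊆ Idem S) (h1 : A ⊆ ζ.1) (h2 : B ∩ ζ.1 = ∅) :
    ∃ g ∈ ζ.1, (∀ a ∈ A, IdemLE g a) ∧ ∀ b ∈ B, b * g = ⊥ := by
  have hex : ∀ b ∈ B, ∃ a ∈ ζ.1, a * b = ⊥ := fun b hb =>
    exists_mul_eq_bot hζ (hB' hb) fun hbz => (Set.eq_empty_iff_forall_notMem.1 h2) b ⟨hb, hbz⟩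
  choose! c hc hcb using hex
  obtain ⟨g, hg, hle⟩ := exists_mem_le_of_finite (A := A ∪ c '' B) (hA.union (hB.image c)) (by
    rintro x (hx | ⟨b, hb, rfl⟩)
    · exact h1 hx
    · exact hc b hb)
  refine ⟨g, hg, fun a ha => hle a (Or.inl ha), fun b hb => ?_⟩
  have h := hle (c b) (Or.inr ⟨b, hb, rfl⟩)
  rw [idem_comm (hB' hb).2 (ζ.2.subset_idem hg).2]
  unfold IdemLE at h
  rw [h, mul_assoc, hcb b hb, mul_bot']

/-- A tight filter meets every finite outer cover of each of its elements. -/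
theorem exists_mem_of_isOuterCoverOf {η : Filt S} (hη : η ∈ closure (Ultra S)) {e : X ≃. X}
    (he : e ∈ η.1) {Z : Set (X ≃. X)} (hZ : Z.Finite) (hcov : IsOuterCoverOf S Z e) :
    ∃ z ∈ Z, z ∈ η.1 := by
  by_contra! hc
  obtain ⟨ζ, hζ, h1, h2⟩ := exists_ultra_of_tight hη (Set.finite_singleton e) hZ hcov.1
    (by simpa using he)
    (Set.eq_empty_iff_forall_notMem.2 fun z hz => hc z hz.1 hz.2)
  obtain ⟨g, hg, hge, hgz⟩ :=
    exists_mem_orthogonal hζ (Set.finite_singleton e) hZ hcov.1 h1 h2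
  obtain ⟨z, hz, hne⟩ := hcov.2 g ⟨ζ.2.subset_idem hg, hge e rfl⟩
    fun h0 => ζ.2.bot_notMem (h0 ▸ hg)
  exact hne (hgz z hz)

/-- Compactness of the set of tight filters containing `e`: if no finite subfamily of a family of
idempotents is an outer cover for `e`, then some tight filter contains `e` and no member of the
family. -/
theorem exists_tight_disjoint {e : X ≃. X} {Z : Set (X ≃. X)} (hZ : Z ⊆ Idem S)
    (h : ∀ B ⊆ Z, B.Finite → ¬ IsOuterCoverOf S B e) (he : e ∈ Idem S) :
    ∃ η ∈ closure (Ultra S), e ∈ η.1 ∧ ∀ z ∈ Z, z ∉ η.1 := by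
  let K : Set (X ≃. X) → Set (Filt S) := fun B => {ζ | ζ ∈ Ultra S ∧ e ∈ ζ.1 ∧ B ∩ ζ.1 = ∅}
  have hne : ∀ B ⊆ Z, B.Finite → (K B).Nonempty := by
    intro B hB hfin
    have hnot := h B hB hfin
    simp only [IsOuterCoverOf, IsOuterCover, not_and, not_forall] at hnot
    -- A failed cover leaves a nonzero `g ≤ e` orthogonal to `B`; any maximal filter through `g`
    -- contains `e` and avoids `B`.
    obtain ⟨g, ⟨hg, hge⟩, hg0, hno⟩ := hnot (hB.trans hZ)
    push Not at hno
    obtain ⟨ζ, hζ, hgz⟩ := exists_ultra_mem hg hg0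
    refine ⟨ζ, hζ, ζ.2.mem_of_le hgz he hge, Set.eq_empty_iff_forall_notMem.2 ?_⟩
    rintro z ⟨hz, hzz⟩
    have := ζ.2.mul_mem hzz hgz
    rw [hno z hz] at this
    exact ζ.2.bot_notMem this
  let 𝓕 : Filter (Filt S) := ⨅ B : {B : Set (X ≃. X) // B ⊆ Z ∧ B.Finite}, Filter.principal (K B.1)
  have hdir : Directed (· ≥ ·) fun B : {B : Set (X ≃. X) // B ⊆ Z ∧ B.Finite} =>
      Filter.principal (K B.1) := by
    intro B B'
    refine ⟨⟨B.1 ∪ B'.1, Set.union_subset B.2.1 B'.2.1, B.2.2.union B'.2.2⟩, ?_, ?_⟩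
    all_goals
      refine Filter.principal_mono.2 ?_
      rintro ζ ⟨h1, h2, h3⟩
      rw [Set.union_inter_distrib_right, Set.union_empty_iff] at h3
    · exact ⟨h1, h2, h3.1⟩
    · exact ⟨h1, h2, h3.2⟩
  have : Nonempty {B : Set (X ≃. X) // B ⊆ Z ∧ B.Finite} := ⟨⟨∅, by simp, by simp⟩⟩
  have hbot : 𝓕.NeBot := Filter.iInf_neBot_of_directed' hdir fun B =>
    Filter.principal_neBot_iff.2 (hne B.1 B.2.1 B.2.2)
  -- An ultrafilter on the space `Filt S`, concentrated on every `K B`; the required tight filter is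
  -- its limit.
  let 𝓤 := Ultrafilter.of 𝓕
  have hK : ∀ B ⊆ Z, B.Finite → ∀ᶠ ζ in 𝓤, ζ ∈ K B := fun B hB hfin =>
    Ultrafilter.of_le 𝓕 (Filter.mem_iInf_of_mem ⟨B, hB, hfin⟩ (Filter.mem_principal_self _))
  have hK0 := hK ∅ (by simp) (by simp)
  -- The pointwise limit along `𝓤`: an idempotent belongs to it when it belongs to `𝓤`-almost every
  -- `ζ`.
  have hF : IsFilter S {f | f ∈ Idem S ∧ ∀ᶠ ζ : Filt S in (𝓤 : Filter (Filt S)), f ∈ ζ.1} := by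
    refine ⟨fun _ h => h.1, ⟨e, he, hK0.mono fun ζ h => h.2.1⟩, ?_, ?_, ?_⟩
    · rintro ⟨-, hb⟩
      obtain ⟨ζ, hζ⟩ := hb.exists
      exact ζ.2.bot_notMem hζ
    · rintro e f ⟨-, he⟩ hf hle
      exact ⟨hf, he.mono fun ζ h => ζ.2.mem_of_le h hf hle⟩
    · rintro e f ⟨he, he'⟩ ⟨hf, hf'⟩
      exact ⟨idem_mul he hf, (he'.and hf').mono fun ζ h => ζ.2.mul_mem h.1 h.2⟩
  refine ⟨⟨_, hF⟩, ?_, ⟨he, hK0.mono fun ζ h => h.2.1⟩, ?_⟩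
  -- Finitely many conditions true of the limit hold for `𝓤`-almost every `ζ`, hence for some
  -- maximal filter. The negative ones need `𝓤` to be an ultrafilter.
  · refine mem_closure_iff.2 fun U hU hmem => ?_
    obtain ⟨A, B, hA, hB, hA', hB', h1, h2, h3⟩ := exists_basic_subset hU hmem
    have hAe : ∀ᶠ ζ : Filt S in (𝓤 : Filter (Filt S)), ∀ a ∈ A, a ∈ ζ.1 :=
      (Filter.eventually_all_finite hA).2 fun a ha => (h1 ha).2
    have hBe : ∀ᶠ ζ : Filt S in (𝓤 : Filter (Filt S)), ∀ b ∈ B, b ∉ ζ.1 :=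
      (Filter.eventually_all_finite hB).2 fun b hb => Ultrafilter.eventually_not.2 fun hb' =>
        (Set.eq_empty_iff_forall_notMem.1 h2) b ⟨hb, hB' hb, hb'⟩
    obtain ⟨ζ, ⟨ha, hb⟩, hζ⟩ := ((hAe.and hBe).and hK0).exists
    exact ⟨ζ, h3 ⟨ha, Set.eq_empty_iff_forall_notMem.2 fun b h => hb b h.1 h.2⟩, hζ.1⟩
  · rintro z hz ⟨-, hz'⟩
    obtain ⟨ζ, h1, h2⟩ := (hz'.and (hK {z} (by simpa using hz) (by simp))).exists
    exact (Set.eq_empty_iff_forall_notMem.1 h2.2.2) z ⟨rfl, h1⟩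

/-! ### Minimality of the tight groupoid -/

theorem isOpen_units_iff {U : Set (Tight S)} :
    IsOpen[induced (unitArrow (G := Tight S)) inferInstance] U ↔ IsOpen U := by
  rw [induced_unitArrow]

/-- A nonempty open set of tight filters contains all tight filters through some nonzero
idempotent. -/
theorem exists_idem_subset {U : Set (Tight S)} (hU : IsOpen U) (hne : U.Nonempty) :
    ∃ f ∈ Idem S, f ≠ ⊥ ∧ ∀ ξ : Tight S, f ∈ ξ.carrier → ξ ∈ U := by
  obtain ⟨V, hV, rfl⟩ := isOpen_induced_iff.1 hU
  obtain ⟨ξ, hξ⟩ := hne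
  -- At a maximal filter the negative conditions follow from orthogonality to a single element `g`,
  -- so containing `g` alone suffices.
  obtain ⟨ζ, hζV, hζ⟩ := mem_closure_iff.1 ξ.2 V hV hξ
  obtain ⟨A, B, hA, hB, hA', hB', h1, h2, h3⟩ := exists_basic_subset hV hζV
  obtain ⟨g, hg, hgA, hgB⟩ := exists_mem_orthogonal hζ hA hB hB' h1 h2
  refine ⟨g, ζ.2.subset_idem hg, fun h0 => ζ.2.bot_notMem (h0 ▸ hg), fun η hη => h3 ⟨?_, ?_⟩⟩
  · exact fun a ha => η.isFilter.mem_of_le hη (hA' ha) (hgA a ha)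
  · refine Set.eq_empty_iff_forall_notMem.2 ?_
    rintro b ⟨hb, hb'⟩
    have := η.isFilter.mul_mem (show b ∈ η.carrier from hb') hη
    rw [hgB b hb] at this
    exact η.isFilter.bot_notMem this

/-- Minimality of the tight groupoid of an inverse semigroup in terms of outer covers. -/
theorem isMinimal_tight_iff :
    IsMinimal (Tight S) ↔ ∀ e ∈ Idem S, ∀ f ∈ Idem S, e ≠ ⊥ → f ≠ ⊥ →
      ∃ (n : ℕ) (s : Fin n → X ≃. X), (∀ i, s i ∈ S) ∧
        IsOuterCoverOf S (Set.range fun i => s i * f * star (s i)) e := by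
  constructor
  · intro hmin e he f hf he0 hf0
    by_contra hcon
    obtain ⟨η, hη, heη, hdis⟩ := exists_tight_disjoint (S := S) (e := e)
      (Z := (fun s => s * f * star s) '' {s | s ∈ S})
      (by rintro _ ⟨s, hs, rfl⟩; exact conj_idem hs hf)
      (by
        intro B hB hfin hcov
        obtain ⟨T, hT, hTfin, rfl⟩ := Set.exists_subset_image_finite_and.1 ⟨B, hB, hfin, rfl⟩
        have := hTfin.fintype
        refine hcon ⟨Fintype.card T, fun i => ((Fintype.equivFin T).symm i : X ≃. X),
          fun i => hT ((Fintype.equivFin T).symm i).2, ?_⟩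
        convert hcov using 1
        ext z
        constructor
        · rintro ⟨i, rfl⟩
          exact ⟨_, ((Fintype.equivFin T).symm i).2, rfl⟩
        · rintro ⟨t, ht, rfl⟩
          exact ⟨Fintype.equivFin T ⟨t, ht⟩, by simp⟩) he
    let U : Set (Tight S) := ⋃ s ∈ {s | s ∈ S}, {ξ : Tight S | s * f * star s ∈ ξ.carrier}
    have hU : IsOpen U := isOpen_biUnion fun s hs => isOpen_mem S (conj_idem hs hf)
    rcases hmin U (isOpen_units_iff.2 hU) (by
      rintro ξ ξ' ⟨p⟩ hξ
      simp only [U, Set.mem_iUnion₂] at hξ ⊢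
      obtain ⟨s, hs, hξ⟩ := hξ
      refine ⟨p.elt * s, smul_mem p.mem hs, ?_⟩
      have := conj_mem_act ξ.isFilter p.mem hξ
      rw [p.act_eq] at this
      simpa only [Set.mem_ofPred_eq, star_mul, mul_assoc] using this) with h | h
    · obtain ⟨ζ, hζ, hfz⟩ := exists_ultra_mem hf hf0
      have : (⟨ζ, subset_closure hζ⟩ : Tight S) ∈ U := by
        refine Set.mem_iUnion₂.2 ⟨f, hf.1, ?_⟩
        change f * f * star f ∈ ζ.1
        rwa [idem_star hf.2, hf.2, hf.2]
      rw [h] at this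
      exact this
    · have : (⟨η, hη⟩ : Tight S) ∈ U := by rw [h]; trivial
      obtain ⟨s, hs, hmem⟩ := Set.mem_iUnion₂.1 this
      exact hdis _ ⟨s, hs, rfl⟩ hmem
  · intro h U hU hinv
    rw [isOpen_units_iff] at hU
    rcases U.eq_empty_or_nonempty with h0 | hne
    · exact Or.inl h0
    obtain ⟨f, hf, hf0, hsub⟩ := exists_idem_subset hU hne
    refine Or.inr (Set.eq_univ_of_forall fun η => ?_)
    obtain ⟨e, he⟩ := η.isFilter.nonempty
    obtain ⟨n, s, hs, hcov⟩ := h e (η.isFilter.subset_idem he) f hf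
      (fun h0 => η.isFilter.bot_notMem (h0 ▸ he)) hf0
    obtain ⟨_, ⟨i, rfl⟩, hi⟩ := exists_mem_of_isOuterCoverOf η.2 he (Set.finite_range _) hcov
    change s i * f * star (s i) ∈ η.carrier at hi
    -- As `s f s* ≤ s s*`, the filter `η` lies in the domain of `s*`.
    have hd : star (star (s i)) * star (s i) ∈ η.carrier := by
      refine η.isFilter.mem_of_le hi (star_mul_self_idem (sstar_mem (hs i))) ?_
      unfold IdemLE
      rw [star_star, mul_assoc (s i * f), ← mul_assoc (star (s i))]
      have := mul_star_mul (star (s i))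
      rw [star_star] at this
      rw [this]
    refine hinv _ _ (inv (Tight.germ (star (s i)) (sstar_mem (hs i)) η hd)) (hsub _ ?_)
    refine (mem_act_iff η.isFilter (sstar_mem (hs i)) hd).2 ⟨hf, ?_⟩
    rwa [star_star]

end Filters

/-! ### Equivariance and domains of elements of `S_Λ` -/

section Paths

variable {C : Type u} [Category.{v} C]

theorem self_mem_extensions (α : Mor C) : α ∈ extensions α :=
  ⟨α.dom, 𝟙 _, by rw [Category.id_comp]⟩

theorem extensions_trans {α β γ : Mor C} (h : β ∈ extensions α) (h' : γ ∈ extensions β) :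
    γ ∈ extensions α := by
  obtain ⟨x, g, rfl⟩ := h
  obtain ⟨y, k, rfl⟩ := h'
  exact ⟨y, k ≫ g, by rw [Category.assoc]⟩

theorem cod_eq_of_mem_extensions {α γ : Mor C} (h : γ ∈ extensions α) : γ.cod = α.cod := by
  obtain ⟨x, g, rfl⟩ := h
  rfl

variable [LeftCancellative C]

theorem tau_mem_SLambda (α : Mor C) : tau α ∈ SLambda C :=
  Subsemigroup.subset_closure (Or.inr ⟨α, rfl⟩)

theorem sigma_mem_SLambda (α : Mor C) : sigma α ∈ SLambda C :=
  Subsemigroup.subset_closure (Or.inl ⟨α, rfl⟩)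

theorem mem_extensions {α γ : Mor C} : γ ∈ extensions α ↔ ∃ β, γ ∈ tau α β := by
  constructor
  · rintro ⟨x, g, rfl⟩
    exact ⟨⟨g⟩, mem_tau.2 ⟨x, g, rfl, rfl⟩⟩
  · rintro ⟨β, h⟩
    obtain ⟨x, g, -, rfl⟩ := mem_tau.1 h
    exact ⟨x, g, rfl⟩

/-- A partial bijection of `Λ` commutes with right multiplication. -/
def IsEquivariant (s : Mor C ≃. Mor C) : Prop :=
  ∀ a b, b ∈ s a → ∀ ρ a', a' ∈ tau a ρ → ∃ b', b' ∈ tau b ρ ∧ b' ∈ s a'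

theorem isEquivariant_tau (α : Mor C) : IsEquivariant (tau α) := by
  intro a b hb ρ a' ha'
  obtain ⟨x, g, rfl, rfl⟩ := mem_tau.1 hb
  obtain ⟨y, k, rfl, rfl⟩ := mem_tau.1 ha'
  exact ⟨⟨k ≫ g ≫ α.hom⟩, mem_tau.2 ⟨y, k, rfl, rfl⟩,
    mem_tau.2 ⟨y, k ≫ g, rfl, by rw [Category.assoc]⟩⟩

theorem isEquivariant_sigma (α : Mor C) : IsEquivariant (sigma α) := by
  intro a b hb ρ a' ha'
  obtain ⟨x, g, rfl, rfl⟩ := mem_sigma.1 hb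
  obtain ⟨y, k, rfl, rfl⟩ := mem_tau.1 ha'
  exact ⟨⟨k ≫ g⟩, mem_tau.2 ⟨y, k, rfl, rfl⟩,
    mem_sigma.2 ⟨y, k ≫ g, rfl, by rw [Category.assoc]⟩⟩

theorem isEquivariant_of_mem {s : Mor C ≃. Mor C} (hs : s ∈ SLambda C) : IsEquivariant s := by
  change s ∈ Subsemigroup.closure _ at hs
  induction hs using Subsemigroup.closure_induction with
  | mem x hx =>
    rcases hx with ⟨α, rfl⟩ | ⟨α, rfl⟩
    · exact isEquivariant_sigma α
    · exact isEquivariant_tau α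
  | mul s t _ _ ihs iht =>
    intro a c hc ρ a' ha'
    obtain ⟨b, hb, hc⟩ := mem_mul.1 hc
    obtain ⟨b', hb', hb''⟩ := iht a b hb ρ a' ha'
    obtain ⟨c', hc', hc''⟩ := ihs b c hc ρ b' hb'
    exact ⟨c', hc', mem_mul.2 ⟨b', hb'', hc''⟩⟩

/-- The identity at `s(a)` can be multiplied onto `a` from the right, hence also onto `b`. -/
theorem IsEquivariant.dom_eq {s : Mor C ≃. Mor C} (hs : IsEquivariant s) {a b : Mor C}
    (h : b ∈ s a) : b.dom = a.dom := by
  obtain ⟨b', hb', -⟩ := hs a b h ⟨𝟙 a.dom⟩ _ (mem_tau.2 ⟨_, 𝟙 a.dom, rfl, rfl⟩)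
  obtain ⟨x, g, h1, -⟩ := mem_tau.1 hb'
  exact (congrArg Mor.cod h1).symm

theorem IsEquivariant.mem_extensions {s : Mor C ≃. Mor C} (hs : IsEquivariant s)
    {a b a' : Mor C} (h : b ∈ s a) (ha' : a' ∈ extensions a) : ∃ b' ∈ extensions b, b' ∈ s a' := by
  obtain ⟨ρ, hρ⟩ := LCSC.mem_extensions.1 ha'
  obtain ⟨b', hb', hb''⟩ := hs a b h ρ a' hρ
  exact ⟨b', LCSC.mem_extensions.2 ⟨ρ, hb'⟩, hb''⟩

/-- Idempotents are thus identity maps on right ideals, so a common extension of fixed points shows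
a product to be nonzero. -/
theorem idem_mem_extensions {e : Mor C ≃. Mor C} (he : e ∈ Idem (SLambda C))
    {a a' : Mor C} (h : a ∈ e a) (ha' : a' ∈ extensions a) : a' ∈ e a' := by
  obtain ⟨b', -, hb'⟩ := (isEquivariant_of_mem he.1).mem_extensions h ha'
  obtain rfl := idem_fix he.2 hb'
  exact hb'

/-- The domain of each element of `S_Λ` is a finite union of sets `κΛ`. -/
theorem exists_finite_base (hC : FinitelyAligned C) {s : Mor C ≃. Mor C} (hs : s ∈ SLambda C) :
    ∃ K : Finset (Mor C), (∀ κ ∈ K, ∃ b, b ∈ s κ) ∧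
      ∀ a b, b ∈ s a → ∃ κ ∈ K, a ∈ extensions κ := by
  classical
  change s ∈ Subsemigroup.closure _ at hs
  induction hs using Subsemigroup.closure_induction with
  | mem x hx =>
    rcases hx with ⟨α, rfl⟩ | ⟨α, rfl⟩
    · refine ⟨{α}, ?_, ?_⟩
      · simp only [Finset.mem_singleton, forall_eq]
        exact ⟨⟨𝟙 α.dom⟩, mem_sigma.2 ⟨_, 𝟙 _, rfl, by rw [Category.id_comp]⟩⟩
      · intro a b hb
        exact ⟨α, by simp, mem_extensions.2 ⟨b, (PEquiv.mem_iff_mem _).1 hb⟩⟩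
    · refine ⟨{⟨𝟙 α.dom⟩}, ?_, ?_⟩
      · simp only [Finset.mem_singleton, forall_eq]
        exact ⟨⟨𝟙 α.dom ≫ α.hom⟩, mem_tau.2 ⟨_, 𝟙 _, rfl, rfl⟩⟩
      · intro a b hb
        obtain ⟨x, g, rfl, rfl⟩ := mem_tau.1 hb
        exact ⟨⟨𝟙 α.dom⟩, by simp, x, g, by rw [Category.comp_id]⟩
  | mul s t hs ht ihs iht =>
    obtain ⟨K, hK, hK'⟩ := ihs
    obtain ⟨L, hL, hL'⟩ := iht
    have hs' : IsEquivariant s := isEquivariant_of_mem hs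
    have ht' : IsEquivariant t := isEquivariant_of_mem ht
    have hts : IsEquivariant (star t) := isEquivariant_of_mem (sstar_mem (S := SLambda C) ht)
    choose Γ hΓ using hC
    let f : Mor C → Mor C := fun c => (star t c).getD c
    -- The domain of `s t` is the union of the sets `t*(κΛ ∩ t(l)Λ)`. Finite alignment splits each
    -- intersection into sets `γΛ`, and `t*` maps `γΛ` onto `t*(γ)Λ`.
    refine ⟨L.biUnion fun l => K.biUnion fun κ =>
      ((Γ κ ((t l).getD l)).image f), ?_, ?_⟩
    · intro m hm
      simp only [Finset.mem_biUnion, Finset.mem_image] at hm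
      obtain ⟨l, hl, κ, hκ, c, hc, rfl⟩ := hm
      have hc' : c ∈ extensions κ ∩ extensions ((t l).getD l) := by
        rw [hΓ]
        exact Set.mem_biUnion (Finset.mem_coe.2 hc) (self_mem_extensions c)
      obtain ⟨d, hd⟩ := hL l hl
      have hd1 : (t l).getD l = d := by rw [Option.mem_def.1 hd]; rfl
      rw [hd1] at hc'
      obtain ⟨b, hb⟩ := hK κ hκ
      obtain ⟨b', -, hb'⟩ := hs'.mem_extensions hb hc'.1
      obtain ⟨a', -, ha'⟩ := hts.mem_extensions (mem_star.2 hd) hc'.2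
      have hfc : f c = a' := by
        change (star t c).getD c = a'
        rw [Option.mem_def.1 ha']; rfl
      exact ⟨b', mem_mul.2 ⟨c, by rw [hfc]; exact mem_star.1 ha', hb'⟩⟩
    · intro a b hb
      obtain ⟨c, hc, hb⟩ := mem_mul.1 hb
      obtain ⟨κ, hκ, hcκ⟩ := hK' c b hb
      obtain ⟨l, hl, hal⟩ := hL' a c hc
      obtain ⟨d, hd⟩ := hL l hl
      have hd1 : (t l).getD l = d := by rw [Option.mem_def.1 hd]; rfl
      obtain ⟨c', hc', hc''⟩ := ht'.mem_extensions hd hal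
      obtain rfl : c = c' := Option.mem_unique hc hc''
      have hmem : c ∈ extensions κ ∩ extensions ((t l).getD l) := ⟨hcκ, by rwa [hd1]⟩
      have hsub := hΓ κ ((t l).getD l)
      rw [hsub] at hmem
      simp only [Set.mem_iUnion] at hmem
      obtain ⟨γ, hγ, hcγ⟩ := hmem
      have hγ' : γ ∈ extensions κ ∩ extensions ((t l).getD l) := by
        rw [hsub]
        exact Set.mem_biUnion (Finset.mem_coe.2 hγ) (self_mem_extensions γ)
      rw [hd1] at hγ'
      obtain ⟨a', -, ha'⟩ := hts.mem_extensions (mem_star.2 hd) hγ'.2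
      have hfc : f γ = a' := by
        change (star t γ).getD γ = a'
        rw [Option.mem_def.1 ha']; rfl
      refine ⟨f γ, ?_, ?_⟩
      · simp only [Finset.mem_biUnion, Finset.mem_image]
        exact ⟨l, hl, κ, hκ, γ, hγ, rfl⟩
      · rw [hfc]
        obtain ⟨a₁, ha₁, ha₁'⟩ := hts.mem_extensions ha' hcγ
        obtain rfl : a = a₁ := Option.mem_unique (mem_star.2 hc) ha₁'
        exact ha₁

/-! ### Outer covers and exhaustive sets -/

theorem mem_tau_mul_sigma {α a : Mor C} : a ∈ (tau α * sigma α) a ↔ a ∈ extensions α := by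
  rw [mem_mul, mem_extensions]
  constructor
  · rintro ⟨b, -, hb⟩
    exact ⟨b, hb⟩
  · rintro ⟨b, hb⟩
    exact ⟨b, (PEquiv.mem_iff_mem _).2 hb, hb⟩

theorem tau_mul_sigma_idem (α : Mor C) : tau α * sigma α ∈ Idem (SLambda C) :=
  self_mul_star_idem (tau_mem_SLambda α)

theorem sigma_mul_tau_idem (α : Mor C) : sigma α * tau α ∈ Idem (SLambda C) :=
  star_mul_self_idem (tau_mem_SLambda α)

/-- Outer covers of the idempotents of `S_Λ` in terms of finite exhaustive sets. -/
theorem outerCover_iff_exhaustive (hC : FinitelyAligned C) :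
    (∀ e ∈ Idem (SLambda C), ∀ f ∈ Idem (SLambda C), e ≠ ⊥ → f ≠ ⊥ →
      ∃ (n : ℕ) (s : Fin n → Mor C ≃. Mor C), (∀ i, s i ∈ SLambda C) ∧
        IsOuterCoverOf (SLambda C) (Set.range fun i => s i * f * star (s i)) e) ↔
    ∀ α β : Mor C, ∃ F : Finset (Mor C), IsFiniteExhaustive α F ∧
      ∀ γ ∈ F, Nonempty (γ.dom ⟶ β.dom) := by
  classical
  constructor
  · intro h α β
    have hβ : (⟨𝟙 β.dom⟩ : Mor C) ∈ (sigma β * tau β) ⟨𝟙 β.dom⟩ :=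
      mem_mul.2 ⟨_, mem_tau.2 ⟨_, 𝟙 _, rfl, rfl⟩, mem_sigma.2 ⟨_, 𝟙 _, rfl, rfl⟩⟩
    obtain ⟨n, s, hs, hcov⟩ := h _ (tau_mul_sigma_idem α) _ (sigma_mul_tau_idem β)
      (ne_bot_of_mem (mem_tau_mul_sigma.2 (self_mem_extensions α))) (ne_bot_of_mem hβ)
    have hidem : ∀ i, s i * (sigma β * tau β) * star (s i) ∈ Idem (SLambda C) :=
      fun i => conj_idem (hs i) (sigma_mul_tau_idem β)
    choose K hK hK' using fun i => exists_finite_base hC (hidem i).1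
    -- Discarding generators with another range loses nothing: a generator that meets some `γ ∈ αΛ`
    -- has range `r(α)`.
    refine ⟨(Finset.univ.biUnion K).filter fun γ => γ.cod = α.cod, ⟨?_, ?_⟩, ?_⟩
    · intro γ hγ
      exact (Finset.mem_filter.1 hγ).2
    · intro γ hγ
      obtain ⟨_, ⟨i, rfl⟩, hne⟩ := hcov.2 (tau γ * sigma γ) ⟨tau_mul_sigma_idem γ,
        (idemLE_iff (tau_mul_sigma_idem γ).2 (tau_mul_sigma_idem α).2).2 fun a ha =>
          mem_tau_mul_sigma.2 (extensions_trans hγ (mem_tau_mul_sigma.1 ha))⟩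
        (ne_bot_of_mem (mem_tau_mul_sigma.2 (self_mem_extensions γ)))
      obtain ⟨a, b, hab⟩ := exists_mem_of_ne_bot hne
      obtain ⟨h1, h2⟩ := mem_mul_fix (tau_mul_sigma_idem γ).2 hab
      obtain rfl := idem_fix (hidem i).2 h1
      obtain ⟨κ, hκ, haκ⟩ := hK' i _ _ h1
      rw [mem_tau_mul_sigma] at h2
      refine ⟨κ, Finset.mem_filter.2 ⟨Finset.mem_biUnion.2 ⟨i, Finset.mem_univ _, hκ⟩, ?_⟩,
        _, haκ, h2⟩
      rw [← cod_eq_of_mem_extensions haκ, cod_eq_of_mem_extensions h2,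
        cod_eq_of_mem_extensions hγ]
    · intro γ hγ
      obtain ⟨i, -, hi⟩ := Finset.mem_biUnion.1 (Finset.mem_filter.1 hγ).1
      obtain ⟨b, hb⟩ := hK i γ hi
      -- Here `c = s_i*(γ)` has the source of `γ`, and `τ^β` is defined at `c`, so `c` is the
      -- required morphism from `s(γ)` to `s(β)`.
      obtain ⟨c, hc, hb⟩ := mem_mul.1 hb
      obtain ⟨d, hd, -⟩ := mem_mul.1 hb
      obtain ⟨k, hk, -⟩ := mem_mul.1 hd
      have hdom := (isEquivariant_of_mem (sstar_mem (hs i))).dom_eq hc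
      obtain ⟨x, g, rfl, -⟩ := mem_tau.1 hk
      exact ⟨eqToHom hdom.symm ≫ g⟩
  · intro h e he f hf _ hf0
    obtain ⟨β, β', hβ⟩ := exists_mem_of_ne_bot hf0
    obtain rfl := idem_fix hf.2 hβ
    obtain ⟨K, -, hK⟩ := exists_finite_base hC he.1
    choose F hF hF' using fun α => h α β'
    let G := K.biUnion F
    have hG : ∀ γ : G, ∃ s ∈ SLambda C, γ.1 ∈ (s * f * star s) γ.1 := by
      rintro ⟨γ, hγ⟩
      obtain ⟨α, -, hα⟩ := Finset.mem_biUnion.1 hγ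
      obtain ⟨δ⟩ := hF' α γ hα
      -- This element sends `β'δ`, which `f` fixes, to `γ`; the conjugate of `f` by it therefore
      -- fixes `γ`.
      have h1 : γ ∈ (tau γ * sigma ⟨δ ≫ β'.hom⟩) ⟨δ ≫ β'.hom⟩ :=
        mem_mul.2 ⟨⟨𝟙 γ.dom⟩, mem_sigma.2 ⟨_, 𝟙 _, rfl, by rw [Category.id_comp]⟩,
          mem_tau.2 ⟨_, 𝟙 _, rfl, by rw [Category.id_comp]⟩⟩
      have h2 : (⟨δ ≫ β'.hom⟩ : Mor C) ∈ f ⟨δ ≫ β'.hom⟩ :=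
        idem_mem_extensions hf hβ ⟨_, δ, rfl⟩
      exact ⟨_, smul_mem (tau_mem_SLambda γ) (sigma_mem_SLambda _),
        mem_mul.2 ⟨_, mem_star.2 h1, mem_mul.2 ⟨_, h2, h1⟩⟩⟩
    choose s hs hsγ using hG
    refine ⟨G.card, fun i => s (G.equivFin.symm i), fun i => hs _, ?_, ?_⟩
    · rintro _ ⟨i, rfl⟩
      exact conj_idem (hs _) hf
    · rintro g ⟨hg, hge⟩ hg0
      obtain ⟨μ, μ', hμ⟩ := exists_mem_of_ne_bot hg0
      obtain rfl := idem_fix hg.2 hμ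
      obtain ⟨α, hα, hμα⟩ := hK μ' μ' ((idemLE_iff hg.2 he.2).1 hge _ hμ)
      -- The common extension `ν` of `γ` and `μ'` is fixed both by the conjugate attached to `γ` and
      -- by `g`.
      obtain ⟨γ, hγ, ν, hν, hν'⟩ := (hF α).2 μ' hμα
      have hγG : γ ∈ G := Finset.mem_biUnion.2 ⟨α, hα, hγ⟩
      refine ⟨_, ⟨G.equivFin ⟨γ, hγG⟩, rfl⟩, ?_⟩
      simp only [Equiv.symm_apply_apply]
      exact ne_bot_of_mem (mem_fix_mul
        (idem_mem_extensions (conj_idem (hs _) hf) (hsγ ⟨γ, hγG⟩) hν)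
        (idem_mem_extensions hg hμ hν'))

end Paths

end LCSC

theorem mainTheorem7 {C : Type u} [Category.{v} C] [LeftCancellative C]
    [Countable (Mor C)] (hC : FinitelyAligned C) :
    List.TFAE [
      IsMinimal (Tight (SLambda C)),
      ∀ e ∈ Idem (SLambda C), ∀ f ∈ Idem (SLambda C), e ≠ ⊥ → f ≠ ⊥ →
        ∃ (n : ℕ) (s : Fin n → Mor C ≃. Mor C), (∀ i, s i ∈ SLambda C) ∧
          IsOuterCoverOf (SLambda C) (Set.range fun i => s i * f * star (s i)) e,
      ∀ α β : Mor C, ∃ F : Finset (Mor C), IsFiniteExhaustive α F ∧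
        ∀ γ ∈ F, Nonempty (γ.dom ⟶ β.dom)] := by
  tfae_have 1 ↔ 2 := isMinimal_tight_iff
  tfae_have 2 ↔ 3 := outerCover_iff_exhaustive hC
  tfae_finish
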